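/- Let $\mathcal{T}$ be a (semisimple) rigid $C^*$-tensor category, whose unit $\mathbb{1}$ is not assumed simple, and let $\mathcal{M}$ be a cofinite, semisimple, finitely decomposable left $\mathcal{T}$-module category, i.e. an object of the 2-category $\mathrm{Mod}(\mathcal{T})$ of such module categories, unitary $\mathcal{T}$-module functors and morphisms of module functors. An object $X$ of $\mathcal{M}$ is regarded as the 1-morphism $X:\mathcal{T}\to\mathcal{M}$, $U\mapsto U\mathbin{\tilde\otimes}X$; it is separable if, for a standard right dual $[X^*,\eta:\mathrm{id}_{\mathcal{M}}\to X^*\otimes X,\ \epsilon:X\otimes X^*\to\mathrm{id}_{\mathcal{T}}]$ in $\mathrm{Mod}(\mathcal{T})$, the left dimension $\eta^\dagger\circ\eta\in\mathrm{End}(\mathrm{id}_{\mathcal{M}})$ is invertible. In that case, with $n_X$ its positive square root, $X\otimes X^*$ is the pair of pants algebra in $\mathrm{End}_{\mathcal{T}}(\mathcal{T})\simeq\mathcal{T}$ with multiplication $\mathrm{id}_X\otimes(n_X^{-1}\circ\eta^\dagger)\otimes\mathrm{id}_{X^*}$ and unit $(\mathrm{id}_X\otimes n_X\otimes\mathrm{id}_{X^*})\circ\epsilon^\dagger$.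 Let $A$ be a separable standard Frobenius algebra (SSFA) in $\mathcal{T}$ and let $X$ be a separable object of $\mathcal{M}$ such that $A$ is unitarily $*$-isomorphic to $X\otimes X^*$ (so $\mathcal{M}$ represents the Morita class of $A$). Call $A$ simple if its algebra of bimodule endomorphisms $\mathrm{End}({}_AA_A)$ is one-dimensional, and connected (ergodic) if it is simple and $\dim\mathrm{Hom}_{\mathcal{T}}(\mathbb{1},A)=1$. Then $A$ is connected if and only if $X$ is a simple object of $\mathcal{M}$, i.e. $\mathrm{End}_{\mathcal{M}}(X)\cong\mathbb{C}$. Likewise, $\dim\mathrm{Hom}_{\mathcal{T}}(\mathbb{1},A)=1$ if and only if $X$ is a simple object of $\mathcal{M}$. -/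

import Mathlib

open CategoryTheory MonoidalCategory MonoidalLeftAction

namespace CStarMod

universe v₁ v₂ v₃ v₄ u₁ u₂ u₃ u₄

/-! ### Dagger categories and C*-categories -/

/-- A dagger category: an involutive, identity-on-objects, contravariant endofunctor. -/
class DaggerCategory (C : Type u₁) [Category.{v₁} C] where
  /-- The dagger of a morphism. -/
  dagger : ∀ {X Y : C}, (X ⟶ Y) → (Y ⟶ X)
  dagger_dagger : ∀ {X Y : C} (f : X ⟶ Y), dagger (dagger f) = f
  dagger_id : ∀ X : C, dagger (𝟙 X) = 𝟙 X
  dagger_comp : ∀ {X Y Z : C} (f : X ⟶ Y) (g : Y ⟶ Z), dagger (f ≫ g) = dagger g ≫ dagger f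

postfix:max "†" => DaggerCategory.dagger

section Dagger

variable {C : Type u₁} [Category.{v₁} C] [DaggerCategory C]

/-- `f† ∘ f = 𝟙`. -/
def IsIsometry {X Y : C} (f : X ⟶ Y) : Prop := f ≫ f† = 𝟙 X

/-- `f† ∘ f = 𝟙` and `f ∘ f† = 𝟙`. -/
def IsUnitary {X Y : C} (f : X ⟶ Y) : Prop := f ≫ f† = 𝟙 X ∧ f† ≫ f = 𝟙 Y

/-- `f = g† ∘ g` for some morphism `g` out of `X`. -/
def IsPositive {X : C} (f : X ⟶ X) : Prop := ∃ (Y : C) (g : X ⟶ Y), f = g ≫ g†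

/-- `p = p† = p ∘ p`. -/
def IsDaggerIdempotent {X : C} (p : X ⟶ X) : Prop := p† = p ∧ p ≫ p = p

end Dagger

/-- A `C*`-category: a `ℂ`-linear category with an antilinear dagger whose Hom-spaces are Banach
spaces, with `‖g ∘ f‖ ≤ ‖g‖ ‖f‖`, `‖f† ∘ f‖ = ‖f‖ ^ 2`, and such that `f† ∘ f` is a positive
element of the `C*`-algebra `End X` for every `f : X ⟶ Y`. -/
class CStarCategory (C : Type u₁) [Category.{v₁} C] [Preadditive C] [Linear ℂ C] extends
    DaggerCategory C where
  dagger_add : ∀ {X Y : C} (f g : X ⟶ Y), dagger (f + g) = dagger f + dagger g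
  dagger_smul : ∀ {X Y : C} (z : ℂ) (f : X ⟶ Y), dagger (z • f) = (starRingEnd ℂ z) • dagger f
  /-- The norms on the Hom-spaces. -/
  homNorm : ∀ X Y : C, Norm (X ⟶ Y)
  norm_core : ∀ X Y : C, @NormedSpace.Core ℂ (X ⟶ Y) _ _ _ (homNorm X Y)
  complete : ∀ X Y : C,
    letI := homNorm X Y
    letI := NormedAddCommGroup.ofCore (norm_core X Y)
    CompleteSpace (X ⟶ Y)
  norm_comp_le : ∀ {X Y Z : C} (f : X ⟶ Y) (g : Y ⟶ Z),
    (homNorm X Z).norm (f ≫ g) ≤ (homNorm Y Z).norm g * (homNorm X Y).norm f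
  norm_dagger_comp_self : ∀ {X Y : C} (f : X ⟶ Y),
    (homNorm X X).norm (f ≫ dagger f) = (homNorm X Y).norm f ^ 2
  dagger_comp_self_pos : ∀ {X Y : C} (f : X ⟶ Y), ∃ g : X ⟶ X, f ≫ dagger f = g ≫ dagger g

/-- A semisimple `C*`-category: it has a zero object and pairwise direct sums, dagger idempotents
split, and endomorphism algebras are finite-dimensional. -/
class SemisimpleCStarCategory (C : Type u₁) [Category.{v₁} C] [Preadditive C] [Linear ℂ C]
    [CStarCategory C] : Prop where
  exists_zero : ∃ Z : C, Subsingleton (Z ⟶ Z)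
  exists_directSum : ∀ X Y : C, ∃ (S : C) (i : X ⟶ S) (j : Y ⟶ S),
    IsIsometry i ∧ IsIsometry j ∧ i† ≫ i + j† ≫ j = 𝟙 S
  exists_splitting : ∀ {X : C} (p : X ⟶ X), IsDaggerIdempotent p →
    ∃ (V : C) (i : V ⟶ X), IsIsometry i ∧ i† ≫ i = p
  finiteDimensional_end : ∀ X : C, FiniteDimensional ℂ (X ⟶ X)

/-- An object `X` with `End X ≅ ℂ`. -/
def IsSimpleObject {C : Type u₁} [Category.{v₁} C] [Preadditive C] [Linear ℂ C] (X : C) : Prop :=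
  Module.finrank ℂ (X ⟶ X) = 1

section Trace

variable {C : Type u₁} [Category.{v₁} C] [Preadditive C] [DaggerCategory C]

/-- A minimal projection of the `*`-algebra `End X`. -/
def IsMinimalProjection {X : C} (p : X ⟶ X) : Prop :=
  IsDaggerIdempotent p ∧ p ≠ 0 ∧
    ∀ q : X ⟶ X, IsDaggerIdempotent q → q ≫ p = q → p ≫ q = q → q = 0 ∨ q = p

/-- A linear functional on `End X` which maps every minimal projection to `1`. If `End X` is a
commutative finite-dimensional `C*`-algebra, there is exactly one. -/
def IsCanonicalTrace [Linear ℂ C] {X : C} (τ : (X ⟶ X) →ₗ[ℂ] ℂ) : Prop :=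
  ∀ p : X ⟶ X, IsMinimalProjection p → τ p = 1

end Trace

/-! ### Rigid C*-tensor categories -/

/-- A (semisimple) rigid `C*`-tensor category. The tensor product is bilinear and compatible with
the dagger, the associator and the unitors are unitary, and every object `X` has a right dual,
that is an object `Y` with morphisms `𝟙 ⟶ Y ⊗ X` and `X ⊗ Y ⟶ 𝟙` that satisfy the snake
equations. The unit object need not be simple. -/
class RigidCStarTensorCategory (T : Type u₁) [Category.{v₁} T] [Preadditive T] [Linear ℂ T]
    [CStarCategory T] [MonoidalCategory T] : Prop extends
    MonoidalPreadditive T, MonoidalLinear ℂ T, SemisimpleCStarCategory T where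
  dagger_whiskerLeft : ∀ (X : T) {Y Z : T} (f : Y ⟶ Z), (X ◁ f)† = X ◁ f†
  dagger_whiskerRight : ∀ {X Y : T} (f : X ⟶ Y) (Z : T), (f ▷ Z)† = f† ▷ Z
  associator_unitary : ∀ X Y Z : T, (α_ X Y Z).hom† = (α_ X Y Z).inv
  leftUnitor_unitary : ∀ X : T, (λ_ X).hom† = (λ_ X).inv
  rightUnitor_unitary : ∀ X : T, (ρ_ X).hom† = (ρ_ X).inv
  exists_rightDual : ∀ X : T, ∃ Y : T, Nonempty (ExactPairing Y X)

/-! ### Standard separable Frobenius algebras -/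

section Frobenius

open scoped MonObj

variable (T : Type u₁) [Category.{v₁} T] [Preadditive T] [Linear ℂ T] [CStarCategory T]
  [MonoidalCategory T]

/-- A separable standard Frobenius algebra (SSFA) in `T`. -/
structure SSFA where
  /-- The underlying object. -/
  X : T
  /-- The multiplication and the unit, with associativity and unitality. -/
  [mon : MonObj X]
  frobenius_left : X ◁ μ[X]† ≫ (α_ X X X).inv ≫ μ[X] ▷ X = μ[X] ≫ μ[X]†
  frobenius_right : μ[X]† ▷ X ≫ (α_ X X X).hom ≫ X ◁ μ[X] = μ[X] ≫ μ[X]†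
  /-- Separability: `m ∘ m† = 𝟙`. -/
  separable : μ[X]† ≫ μ[X] = 𝟙 X
  /-- Standardness: the self-duality of `X` with cup `m† ∘ u` and cap `u† ∘ m` is a standard
  duality, that is, the left and the right trace agree after composition with the canonical trace
  of `End 𝟙`. -/
  standard : ∃ τ : (𝟙_ T ⟶ 𝟙_ T) →ₗ[ℂ] ℂ, IsCanonicalTrace τ ∧ ∀ t : X ⟶ X,
    τ ((η[X] ≫ μ[X]†) ≫ X ◁ t ≫ (η[X] ≫ μ[X]†)†) =
      τ ((μ[X] ≫ η[X]†)† ≫ t ▷ X ≫ μ[X] ≫ η[X]†)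

attribute [instance] SSFA.mon

variable {T}

namespace SSFA

variable [MonoidalPreadditive T] [MonoidalLinear ℂ T]

/-- The bimodule endomorphisms of the identity `A`-`A` bimodule. -/
def bimoduleEnd (A : SSFA T) : Submodule ℂ (A.X ⟶ A.X) where
  carrier := {f | μ[A.X] ≫ f = A.X ◁ f ≫ μ[A.X] ∧ μ[A.X] ≫ f = f ▷ A.X ≫ μ[A.X]}
  add_mem' := by
    rintro f g ⟨h1, h2⟩ ⟨h3, h4⟩
    constructor
    · rw [Preadditive.comp_add, h1, h3, MonoidalPreadditive.whiskerLeft_add, Preadditive.add_comp]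
    · rw [Preadditive.comp_add, h2, h4, MonoidalPreadditive.add_whiskerRight, Preadditive.add_comp]
  zero_mem' := by simp
  smul_mem' := by
    rintro z f ⟨h1, h2⟩
    constructor
    · rw [Linear.comp_smul, h1, MonoidalLinear.whiskerLeft_smul, Linear.smul_comp]
    · rw [Linear.comp_smul, h2, MonoidalLinear.smul_whiskerRight, Linear.smul_comp]

/-- `A` is simple: `End (_A A_A)` is one-dimensional. -/
def IsSimple (A : SSFA T) : Prop := Module.finrank ℂ A.bimoduleEnd = 1

/-- `A` is connected (ergodic): it is simple and `Hom(𝟙, A)` is one-dimensional. -/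
def IsConnected (A : SSFA T) : Prop :=
  A.IsSimple ∧ Module.finrank ℂ (𝟙_ T ⟶ A.X) = 1

end SSFA

end Frobenius

/-! ### Module categories -/

section ModuleCategory

/-- The action of the rigid `C*`-tensor category `T` makes the semisimple `C*`-category `M` a
semisimple left `T`-module category: the action is a unitary linear bifunctor with unitary
coherence isomorphisms. -/
class SemisimpleModuleCategory (T : Type u₁) [Category.{v₁} T] [Preadditive T] [Linear ℂ T]
    [CStarCategory T] [MonoidalCategory T] (M : Type u₂) [Category.{v₂} M] [Preadditive M]
    [Linear ℂ M] [CStarCategory M] [MonoidalLeftAction T M] : Prop extends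
    SemisimpleCStarCategory M where
  add_actionHomLeft : ∀ {U V : T} (f g : U ⟶ V) (X : M), (f + g) ⊵ₗ X = f ⊵ₗ X + g ⊵ₗ X
  smul_actionHomLeft : ∀ {U V : T} (z : ℂ) (f : U ⟶ V) (X : M), (z • f) ⊵ₗ X = z • f ⊵ₗ X
  actionHomRight_add : ∀ (U : T) {X Y : M} (f g : X ⟶ Y), U ⊴ₗ (f + g) = U ⊴ₗ f + U ⊴ₗ g
  actionHomRight_smul : ∀ (U : T) {X Y : M} (z : ℂ) (f : X ⟶ Y), U ⊴ₗ (z • f) = z • U ⊴ₗ f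
  dagger_actionHomLeft : ∀ {U V : T} (f : U ⟶ V) (X : M), (f ⊵ₗ X)† = f† ⊵ₗ X
  dagger_actionHomRight : ∀ (U : T) {X Y : M} (f : X ⟶ Y), (U ⊴ₗ f)† = U ⊴ₗ f†
  actionAssocIso_unitary : ∀ (U V : T) (X : M), (αₗ U V X).hom† = (αₗ U V X).inv
  actionUnitIso_unitary : ∀ X : M, (λₗ[T] X).hom† = (λₗ[T] X).inv

variable (T : Type u₁) [Category.{v₁} T] [Preadditive T] [Linear ℂ T] [CStarCategory T]
  [MonoidalCategory T]

/-- `T` is a left module category over itself. -/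
instance selfModuleCategory [RigidCStarTensorCategory T] : SemisimpleModuleCategory T T where
  add_actionHomLeft f g _ := MonoidalPreadditive.add_whiskerRight f g
  smul_actionHomLeft z f X := MonoidalLinear.smul_whiskerRight z f X
  actionHomRight_add _ _ _ f g := MonoidalPreadditive.whiskerLeft_add f g
  actionHomRight_smul U _ _ z f := MonoidalLinear.whiskerLeft_smul U z f
  dagger_actionHomLeft f X := RigidCStarTensorCategory.dagger_whiskerRight f X
  dagger_actionHomRight U _ _ f := RigidCStarTensorCategory.dagger_whiskerLeft U f
  actionAssocIso_unitary U V X := RigidCStarTensorCategory.associator_unitary U V X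
  actionUnitIso_unitary X := RigidCStarTensorCategory.leftUnitor_unitary X

variable (M : Type u₂) [Category.{v₂} M] [Preadditive M] [Linear ℂ M] [CStarCategory M]
  [MonoidalLeftAction T M]

/-- `M` is cofinite: for all `X, Y` in `M`, up to isomorphism only finitely many simple objects
`U` of `T` satisfy `Hom(X, U ⊙ Y) ≠ 0`. -/
def IsCofinite : Prop :=
  ∀ X Y : M, ∃ S : Set T, S.Finite ∧ ∀ U : T, IsSimpleObject U →
    (∃ f : X ⟶ U ⊙ₗ Y, f ≠ 0) → ∃ V ∈ S, Nonempty (U ≅ V)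

variable {M}

/-- The full subcategory `R` of the `T`-module category `M` is the (internal) direct sum of its
full `T`-stable subcategories `P i`: there are no nonzero morphisms between objects of different
summands, and every object of `R` is a direct sum of objects of the summands. -/
structure IsDirectSumDecomposition (R : ObjectProperty M) {n : ℕ}
    (P : Fin n → ObjectProperty M) : Prop where
  le : ∀ i, P i ≤ R
  isClosedUnderIsomorphisms : ∀ i, (P i).IsClosedUnderIsomorphisms
  action_mem : ∀ i (U : T) (X : M), P i X → P i (U ⊙ₗ X)
  hom_eq_zero : ∀ i j, i ≠ j → ∀ (X Y : M), P i X → P j Y → ∀ f : X ⟶ Y, f = 0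
  exists_directSum : ∀ X : M, R X → ∃ (Z : Fin n → M) (ι : ∀ i, Z i ⟶ X),
    (∀ i, P i (Z i)) ∧ (∀ i, IsIsometry (ι i)) ∧ ∑ i, (ι i)† ≫ ι i = 𝟙 X

/-- `R` is not a direct sum of two nonzero `T`-module categories. -/
def IsIndecomposable (R : ObjectProperty M) : Prop :=
  ∀ P : Fin 2 → ObjectProperty M, IsDirectSumDecomposition T R P →
    ∃ i, ∀ X : M, P i X → 𝟙 X = 0

variable (M)

/-- `M` is a finite direct sum of indecomposable `T`-module categories. -/
def IsFinitelyDecomposable : Prop :=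
  ∃ (n : ℕ) (P : Fin n → ObjectProperty M),
    IsDirectSumDecomposition T (fun _ : M => True) P ∧ ∀ i, IsIndecomposable T (P i)

end ModuleCategory

/-! ### The Hom-categories of the 2-category of module categories -/

section ModuleFunctor

variable (T : Type u₁) [Category.{v₁} T] [Preadditive T] [Linear ℂ T] [CStarCategory T]
  [MonoidalCategory T]
  (M : Type u₂) [Category.{v₂} M] [Preadditive M] [Linear ℂ M] [CStarCategory M]
  [MonoidalLeftAction T M]
  (N : Type u₃) [Category.{v₃} N] [Preadditive N] [Linear ℂ N] [CStarCategory N]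
  [MonoidalLeftAction T N]
  (K : Type u₄) [Category.{v₄} K] [Preadditive K] [Linear ℂ K] [CStarCategory K]
  [MonoidalLeftAction T K]

/-- A unitary `T`-module functor `M → N`: a unitary linear functor `F` with a unitary natural
isomorphism `δₗ : F (U ⊙ X) ⟶ U ⊙ F X` satisfying the associativity and unit coherences. -/
structure ModuleFunctor where
  /-- The underlying functor. -/
  F : M ⥤ N
  /-- The coherent natural transformation `F (U ⊙ X) ⟶ U ⊙ F X`. -/
  [lin : F.OplaxLeftLinear T]
  map_add : ∀ {X Y : M} (f g : X ⟶ Y), F.map (f + g) = F.map f + F.map g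
  map_smul : ∀ {X Y : M} (z : ℂ) (f : X ⟶ Y), F.map (z • f) = z • F.map f
  map_dagger : ∀ {X Y : M} (f : X ⟶ Y), F.map f† = (F.map f)†
  unitary : ∀ (U : T) (X : M), IsUnitary (Functor.OplaxLeftLinear.δₗ F U X)

attribute [instance] ModuleFunctor.lin

variable {T M N K}

namespace ModuleFunctor

/-- The structure isomorphism `F (U ⊙ X) ⟶ U ⊙ F X`. -/
abbrev δ (G : ModuleFunctor T M N) (U : T) (X : M) : G.F.obj (U ⊙ₗ X) ⟶ U ⊙ₗ G.F.obj X :=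
  Functor.OplaxLeftLinear.δₗ G.F U X

variable [SemisimpleModuleCategory T N]

/-- The morphisms of `T`-module functors, as a subspace of the natural transformations. -/
def homSubmodule (G H : ModuleFunctor T M N) : Submodule ℂ (G.F ⟶ H.F) where
  carrier := {α | ∀ (U : T) (X : M), α.app (U ⊙ₗ X) ≫ H.δ U X = G.δ U X ≫ U ⊴ₗ α.app X}
  add_mem' := by
    intro α β hα hβ U X
    rw [NatTrans.app_add, NatTrans.app_add, Preadditive.add_comp, hα, hβ,
      SemisimpleModuleCategory.actionHomRight_add, Preadditive.comp_add]
  zero_mem' := by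
    intro U X
    have h : U ⊴ₗ (0 : G.F.obj X ⟶ H.F.obj X) = 0 := by
      have := SemisimpleModuleCategory.actionHomRight_smul U (0 : ℂ) (0 : G.F.obj X ⟶ H.F.obj X)
      simpa using this
    rw [NatTrans.app_zero, NatTrans.app_zero, h]
    simp
  smul_mem' := by
    intro z α hα U X
    rw [NatTrans.app_smul, NatTrans.app_smul, Linear.smul_comp, hα,
      SemisimpleModuleCategory.actionHomRight_smul, Linear.comp_smul]

/-- Module functors and their morphisms form a category. -/
instance : Category (ModuleFunctor T M N) where
  Hom G H := homSubmodule G H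
  id G := ⟨𝟙 G.F, fun U X => by simp⟩
  comp α β := ⟨α.1 ≫ β.1, fun U X => by
    rw [NatTrans.comp_app, NatTrans.comp_app, Category.assoc, β.2 U X, ← Category.assoc, α.2 U X,
      Category.assoc, MonoidalLeftAction.actionHomRight_comp]⟩
  id_comp α := Subtype.ext (Category.id_comp α.1)
  comp_id α := Subtype.ext (Category.comp_id α.1)
  assoc α β γ := Subtype.ext (Category.assoc α.1 β.1 γ.1)

/-- The underlying natural transformation. -/
def nat {G H : ModuleFunctor T M N} (α : G ⟶ H) : G.F ⟶ H.F := α.1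

/-- The component of a morphism of module functors at an object. -/
def app {G H : ModuleFunctor T M N} (α : G ⟶ H) (X : M) : G.F.obj X ⟶ H.F.obj X :=
  (nat α).app X

/-- A morphism of module functors from a natural transformation compatible with `δ`. -/
def mkHom {G H : ModuleFunctor T M N} (α : G.F ⟶ H.F)
    (h : ∀ (U : T) (X : M), α.app (U ⊙ₗ X) ≫ H.δ U X = G.δ U X ≫ U ⊴ₗ α.app X) : G ⟶ H :=
  ⟨α, h⟩

@[simp] lemma mkHom_app {G H : ModuleFunctor T M N} (α : G.F ⟶ H.F)
    (h : ∀ (U : T) (X : M), α.app (U ⊙ₗ X) ≫ H.δ U X = G.δ U X ≫ U ⊴ₗ α.app X) (X : M) :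
    app (mkHom α h) X = α.app X := rfl

lemma hom_ext {G H : ModuleFunctor T M N} {α β : G ⟶ H} (h : ∀ X, app α X = app β X) : α = β :=
  Subtype.ext (NatTrans.ext (funext h))

@[simp] lemma id_app (G : ModuleFunctor T M N) (X : M) : app (𝟙 G) X = 𝟙 (G.F.obj X) := rfl

@[simp] lemma comp_app {G H L : ModuleFunctor T M N} (α : G ⟶ H) (β : H ⟶ L) (X : M) :
    app (α ≫ β) X = app α X ≫ app β X := rfl

lemma app_δ {G H : ModuleFunctor T M N} (α : G ⟶ H) (U : T) (X : M) :
    app α (U ⊙ₗ X) ≫ H.δ U X = G.δ U X ≫ U ⊴ₗ app α X := α.2 U X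

lemma naturality {G H : ModuleFunctor T M N} (α : G ⟶ H) {X Y : M} (f : X ⟶ Y) :
    G.F.map f ≫ app α Y = app α X ≫ H.F.map f := α.1.naturality f

instance (G H : ModuleFunctor T M N) : AddCommGroup (G ⟶ H) :=
  inferInstanceAs (AddCommGroup (homSubmodule G H))

instance (G H : ModuleFunctor T M N) : Module ℂ (G ⟶ H) :=
  inferInstanceAs (Module ℂ (homSubmodule G H))

instance : Preadditive (ModuleFunctor T M N) where
  add_comp _ _ _ α β γ := Subtype.ext (Preadditive.add_comp _ _ _ α.1 β.1 γ.1)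
  comp_add _ _ _ α β γ := Subtype.ext (Preadditive.comp_add _ _ _ α.1 β.1 γ.1)

instance : Linear ℂ (ModuleFunctor T M N) where
  smul_comp _ _ _ z α β := Subtype.ext (Linear.smul_comp _ _ _ z α.1 β.1)
  comp_smul _ _ _ α z β := Subtype.ext (Linear.comp_smul _ _ _ α.1 z β.1)

/-- The dagger of a morphism of module functors is defined componentwise. -/
def homDagger {G H : ModuleFunctor T M N} (α : G ⟶ H) : H ⟶ G :=
  mkHom
    { app := fun X => (app α X)†
      naturality := fun X Y f => by
        have h := congrArg DaggerCategory.dagger (naturality α f†)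
        rw [DaggerCategory.dagger_comp, DaggerCategory.dagger_comp, G.map_dagger, H.map_dagger,
          DaggerCategory.dagger_dagger, DaggerCategory.dagger_dagger] at h
        exact h.symm }
    (fun U X => by
      have h := congrArg DaggerCategory.dagger (app_δ α U X)
      rw [DaggerCategory.dagger_comp, DaggerCategory.dagger_comp,
        SemisimpleModuleCategory.dagger_actionHomRight] at h
      calc (app α (U ⊙ₗ X))† ≫ G.δ U X
          = (H.δ U X ≫ (H.δ U X)†) ≫ (app α (U ⊙ₗ X))† ≫ G.δ U X := by
            rw [(H.unitary U X).1, Category.id_comp]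
        _ = H.δ U X ≫ ((H.δ U X)† ≫ (app α (U ⊙ₗ X))†) ≫ G.δ U X := by simp only [Category.assoc]
        _ = H.δ U X ≫ U ⊴ₗ (app α X)† := by
            rw [h, Category.assoc, (G.unitary U X).2, Category.comp_id])

instance : DaggerCategory (ModuleFunctor T M N) where
  dagger α := homDagger α
  dagger_dagger α := hom_ext fun X => DaggerCategory.dagger_dagger (app α X)
  dagger_id G := hom_ext fun X => DaggerCategory.dagger_id (G.F.obj X)
  dagger_comp α β := hom_ext fun X => DaggerCategory.dagger_comp (app α X) (app β X)

@[simp] lemma dagger_app {G H : ModuleFunctor T M N} (α : G ⟶ H) (X : M) :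
    app (α†) X = (app α X)† := rfl

end ModuleFunctor

end ModuleFunctor

/-! ### Composition of module functors -/

section Composition

variable {T : Type u₁} [Category.{v₁} T] [Preadditive T] [Linear ℂ T] [CStarCategory T]
  [MonoidalCategory T]
  {M : Type u₂} [Category.{v₂} M] [Preadditive M] [Linear ℂ M] [CStarCategory M]
  [MonoidalLeftAction T M]
  {N : Type u₃} [Category.{v₃} N] [Preadditive N] [Linear ℂ N] [CStarCategory N]
  [MonoidalLeftAction T N]
  {K : Type u₄} [Category.{v₄} K] [Preadditive K] [Linear ℂ K] [CStarCategory K]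
  [MonoidalLeftAction T K]

lemma isUnitary_id {C : Type u₁} [Category.{v₁} C] [DaggerCategory C] (X : C) :
    IsUnitary (𝟙 X) := by
  simp [IsUnitary, DaggerCategory.dagger_id]

lemma IsUnitary.comp {C : Type u₁} [Category.{v₁} C] [DaggerCategory C] {X Y Z : C}
    {f : X ⟶ Y} {g : Y ⟶ Z} (hf : IsUnitary f) (hg : IsUnitary g) : IsUnitary (f ≫ g) := by
  constructor
  · rw [DaggerCategory.dagger_comp, Category.assoc, ← Category.assoc g, hg.1, Category.id_comp,
      hf.1]
  · rw [DaggerCategory.dagger_comp, Category.assoc, ← Category.assoc (f†), hf.2, Category.id_comp,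
      hg.2]

namespace ModuleFunctor

variable (T M) in
/-- The identity module functor. -/
def idFunctor : ModuleFunctor T M M where
  F := 𝟭 M
  lin := { δₗ := fun U X => 𝟙 (U ⊙ₗ X) }
  map_add _ _ := rfl
  map_smul _ _ := rfl
  map_dagger _ := rfl
  unitary U X := isUnitary_id (U ⊙ₗ X)

/-- The composite module functor (`G` first, then `H`). In the 2-category of module categories this
is the 1-morphism `G ⊗ H`. -/
def comp (G : ModuleFunctor T M N) (H : ModuleFunctor T N K) : ModuleFunctor T M K where
  F := G.F ⋙ H.F
  lin :=
    { δₗ := fun U X => H.F.map (G.δ U X) ≫ H.δ U (G.F.obj X)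
      δₗ_naturality_left := fun f X => by
        change H.F.map (G.F.map (f ⊵ₗ X)) ≫ H.F.map (G.δ _ X) ≫ H.δ _ _ =
          (H.F.map (G.δ _ X) ≫ H.δ _ _) ≫ f ⊵ₗ H.F.obj (G.F.obj X)
        rw [← Functor.map_comp_assoc, Functor.OplaxLeftLinear.δₗ_naturality_left,
          Functor.map_comp_assoc, Functor.OplaxLeftLinear.δₗ_naturality_left, Category.assoc]
      δₗ_naturality_right := fun U X Y f => by
        change H.F.map (G.F.map (U ⊴ₗ f)) ≫ H.F.map (G.δ U Y) ≫ H.δ _ _ =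
          (H.F.map (G.δ U X) ≫ H.δ _ _) ≫ U ⊴ₗ H.F.map (G.F.map f)
        rw [← Functor.map_comp_assoc, Functor.OplaxLeftLinear.δₗ_naturality_right,
          Functor.map_comp_assoc, Functor.OplaxLeftLinear.δₗ_naturality_right, Category.assoc]
      δₗ_associativity := fun U V X => by
        change (H.F.map (G.δ (U ⊗ V) X) ≫ H.δ _ _) ≫ (αₗ U V _).hom =
          H.F.map (G.F.map (αₗ U V X).hom) ≫ (H.F.map (G.δ U _) ≫ H.δ _ _) ≫
            U ⊴ₗ (H.F.map (G.δ V X) ≫ H.δ _ _)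
        rw [Category.assoc, Functor.OplaxLeftLinear.δₗ_associativity, ← Functor.map_comp_assoc,
          Functor.OplaxLeftLinear.δₗ_associativity, MonoidalLeftAction.actionHomRight_comp,
          Functor.map_comp_assoc, Functor.map_comp_assoc]
        simp only [Category.assoc]
        rw [← Functor.OplaxLeftLinear.δₗ_naturality_right_assoc]
      δₗ_unitality_inv := fun X => by
        change (λₗ[T] (H.F.obj (G.F.obj X))).inv =
          H.F.map (G.F.map (λₗ[T] X).inv) ≫ H.F.map (G.δ (𝟙_ T) X) ≫ H.δ _ _
        rw [← Functor.map_comp_assoc, ← Functor.OplaxLeftLinear.δₗ_unitality_inv,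
          Functor.OplaxLeftLinear.δₗ_unitality_inv] }
  map_add f g := by simp [G.map_add, H.map_add]
  map_smul z f := by simp [G.map_smul, H.map_smul]
  map_dagger f := by simp [G.map_dagger, H.map_dagger]
  unitary U X := by
    refine IsUnitary.comp ?_ (H.unitary U (G.F.obj X))
    constructor
    · rw [← H.map_dagger, ← H.F.map_comp, (G.unitary U X).1, H.F.map_id]; rfl
    · rw [← H.map_dagger, ← H.F.map_comp, (G.unitary U X).2, H.F.map_id]

/-- The module functor `T → M`, `U ↦ U ⊙ X`, which corresponds to the object `X` of `M` under the
equivalence of `M` with the category of module functors `T → M`. For `M = T` this is the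
module functor `- ⊗ X`. -/
def ofObj [RigidCStarTensorCategory T] [SemisimpleModuleCategory T M] (X : M) :
    ModuleFunctor T T M where
  F :=
    { obj := fun U => U ⊙ₗ X
      map := fun f => f ⊵ₗ X }
  lin :=
    { δₗ := fun U V => (αₗ U V X).hom
      δₗ_naturality_left := fun f V => by simp
      δₗ_naturality_right := fun U V W f => by simp
      δₗ_associativity := fun U V W => by simp
      δₗ_unitality_inv := fun V => by
        change (λₗ[T] (V ⊙ₗ X)).inv = (λ_ V).inv ⊵ₗ X ≫ (αₗ (𝟙_ T) V X).hom
        have h : (λ_ V).hom ⊵ₗ X ≫ (λₗ[T] (V ⊙ₗ X)).inv = (αₗ (𝟙_ T) V X).hom := by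
          rw [MonoidalLeftAction.leftUnitor_actionHom]; simp
        rw [← h, MonoidalLeftAction.inv_hom_actionHomLeft_assoc] }
  map_add f g := SemisimpleModuleCategory.add_actionHomLeft f g X
  map_smul z f := SemisimpleModuleCategory.smul_actionHomLeft z f X
  map_dagger f := (SemisimpleModuleCategory.dagger_actionHomLeft f X).symm
  unitary U V := by
    constructor
    · change (αₗ U V X).hom ≫ (αₗ U V X).hom† = _
      rw [SemisimpleModuleCategory.actionAssocIso_unitary, Iso.hom_inv_id]
      rfl
    · change (αₗ U V X).hom† ≫ (αₗ U V X).hom = _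
      rw [SemisimpleModuleCategory.actionAssocIso_unitary, Iso.inv_hom_id]

variable [SemisimpleModuleCategory T N] [SemisimpleModuleCategory T K]

/-- The 2-morphism `𝟙_G ⊗ β`, with components `β_{G X}`. -/
def whiskL (G : ModuleFunctor T M N) {H L : ModuleFunctor T N K} (β : H ⟶ L) :
    G.comp H ⟶ G.comp L :=
  mkHom (Functor.whiskerLeft G.F (nat β)) fun U X => by
    change app β (G.F.obj (U ⊙ₗ X)) ≫ L.F.map (G.δ U X) ≫ L.δ U (G.F.obj X) =
      (H.F.map (G.δ U X) ≫ H.δ U (G.F.obj X)) ≫ U ⊴ₗ app β (G.F.obj X)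
    rw [← Category.assoc, ← naturality, Category.assoc, app_δ, Category.assoc]

/-- The 2-morphism `α ⊗ 𝟙_H`, with components `H α_X`. -/
def whiskR {G L : ModuleFunctor T M N} (α : G ⟶ L) (H : ModuleFunctor T N K) :
    G.comp H ⟶ L.comp H :=
  mkHom (Functor.whiskerRight (nat α) H.F) fun U X => by
    change H.F.map (app α (U ⊙ₗ X)) ≫ H.F.map (L.δ U X) ≫ H.δ U (L.F.obj X) =
      (H.F.map (G.δ U X) ≫ H.δ U (G.F.obj X)) ≫ U ⊴ₗ H.F.map (app α X)
    rw [← Category.assoc, ← Functor.map_comp, app_δ, Functor.map_comp, Category.assoc,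
      Category.assoc, Functor.OplaxLeftLinear.δₗ_naturality_right]

end ModuleFunctor

end Composition

/-! ### Duals in the 2-category of module categories and pair of pants algebras -/

section Duals

open ModuleFunctor

variable {T : Type u₁} [Category.{v₁} T] [Preadditive T] [Linear ℂ T] [CStarCategory T]
  [MonoidalCategory T]
  {M : Type u₂} [Category.{v₂} M] [Preadditive M] [Linear ℂ M] [CStarCategory M]
  [MonoidalLeftAction T M] [SemisimpleModuleCategory T M]
  {N : Type u₃} [Category.{v₃} N] [Preadditive N] [Linear ℂ N] [CStarCategory N]
  [MonoidalLeftAction T N] [SemisimpleModuleCategory T N]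

/-- A right dual `[X*, η, ε]` of the 1-morphism `X : M → N`: a 1-morphism `X* : N → M` with
2-morphisms `η : id_N ⟶ X* ⊗ X` and `ε : X ⊗ X* ⟶ id_M` that satisfy the snake equations. -/
structure RightDual (X : ModuleFunctor T M N) where
  /-- The dual 1-morphism `X*`. -/
  dual : ModuleFunctor T N M
  /-- The cup. -/
  η : idFunctor T N ⟶ dual.comp X
  /-- The cap. -/
  ε : X.comp dual ⟶ idFunctor T M
  snake_left : ∀ U : M, app η (X.F.obj U) ≫ X.F.map (app ε U) = 𝟙 (X.F.obj U)
  snake_right : ∀ V : N, dual.F.map (app η V) ≫ app ε (dual.F.obj V) = 𝟙 (dual.F.obj V)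

namespace RightDual

variable {X : ModuleFunctor T M N} (D : RightDual X)

/-- `[X*, η, ε]` is a standard dual:
`Tr_N (η† ∘ (𝟙_{X*} ⊗ t) ∘ η) = Tr_M (ε ∘ (t ⊗ 𝟙_{X*}) ∘ ε†)` for all `t : X ⟶ X`. -/
def IsStandard : Prop :=
  ∃ (τN : (idFunctor T N ⟶ idFunctor T N) →ₗ[ℂ] ℂ) (τM : (idFunctor T M ⟶ idFunctor T M) →ₗ[ℂ] ℂ),
    IsCanonicalTrace τN ∧ IsCanonicalTrace τM ∧ ∀ t : X ⟶ X,
      τN (D.η ≫ whiskL D.dual t ≫ D.η†) = τM (D.ε† ≫ whiskR t D.dual ≫ D.ε)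

/-- The left dimension `η† ∘ η` of `X`, an endomorphism of `id_N`. -/
def dimLeft : idFunctor T N ⟶ idFunctor T N := D.η ≫ D.η†

/-- `X` is separable: its left dimension is invertible. -/
def IsSeparable : Prop := IsIso D.dimLeft

/-- `n` is the positive square root of the left dimension of `X` (with its inverse). -/
def IsSqrtDimLeft (n : idFunctor T N ≅ idFunctor T N) : Prop :=
  IsPositive n.hom ∧ n.hom ≫ n.hom = D.dimLeft

end RightDual

variable (T) in
/-- An object of `End_T(T)` with a multiplication and a unit (the data of an algebra). The tensor
product of `End_T(T)` is the composition of functors. -/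
structure EndAlgebra [RigidCStarTensorCategory T] where
  /-- The underlying module functor `T → T`. -/
  H : ModuleFunctor T T T
  /-- The multiplication `H ⊗ H ⟶ H`. -/
  mul : H.comp H ⟶ H
  /-- The unit `id ⟶ H`. -/
  one : idFunctor T T ⟶ H

/-- A unitary `*`-isomorphism: a unitary which preserves multiplication and unit. (For a unitary
algebra isomorphism `θ` between Frobenius algebras, the compatibility with the involutions is
automatic since `θ† = θ⁻¹`.) -/
structure EndAlgebra.IsUnitaryStarIso [RigidCStarTensorCategory T] {P Q : EndAlgebra T}
    (θ : P.H ⟶ Q.H) : Prop where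
  unitary : IsUnitary θ
  map_mul : P.mul ≫ θ = (whiskR θ P.H ≫ whiskL Q.H θ) ≫ Q.mul
  map_one : P.one ≫ θ = Q.one

/-- The image of `A` under the equivalence `T ≃ End_T(T)`, `A ↦ - ⊗ A`. -/
def SSFA.toEnd [RigidCStarTensorCategory T] (A : SSFA T) : EndAlgebra T where
  H := ofObj A.X
  mul := mkHom
    { app := fun U => (α_ U A.X A.X).hom ≫ U ◁ MonObj.mul
      naturality := fun U V f => by
        change (f ▷ A.X) ▷ A.X ≫ (α_ V A.X A.X).hom ≫ V ◁ MonObj.mul =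
          ((α_ U A.X A.X).hom ≫ U ◁ MonObj.mul) ≫ f ▷ A.X
        simp [whisker_exchange] }
    (fun U V => by
      change ((α_ (U ⊗ V) A.X A.X).hom ≫ (U ⊗ V) ◁ MonObj.mul) ≫ (α_ U V A.X).hom =
        ((α_ U V A.X).hom ▷ A.X ≫ (α_ U (V ⊗ A.X) A.X).hom) ≫
          U ◁ ((α_ V A.X A.X).hom ≫ V ◁ MonObj.mul)
      simp)
  one := mkHom
    { app := fun U => (ρ_ U).inv ≫ U ◁ MonObj.one
      naturality := fun U V f => by
        change f ≫ (ρ_ V).inv ≫ V ◁ MonObj.one = ((ρ_ U).inv ≫ U ◁ MonObj.one) ≫ f ▷ A.X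
        simp [whisker_exchange] }
    (fun U V => by
      change ((ρ_ (U ⊗ V)).inv ≫ (U ⊗ V) ◁ MonObj.one) ≫ (α_ U V A.X).hom =
        𝟙 (U ⊗ V) ≫ U ◁ ((ρ_ V).inv ≫ V ◁ MonObj.one)
      simp)

namespace RightDual

variable [RigidCStarTensorCategory T]

section

set_option linter.unusedSectionVars false

variable (X : ModuleFunctor T T M) (D : ModuleFunctor T M T)

lemma mul_naturality (b : ∀ Y : M, X.F.obj (D.F.obj Y) ⟶ Y)
    (hb : ∀ {Y Z : M} (g : Y ⟶ Z), X.F.map (D.F.map g) ≫ b Z = b Y ≫ g) {U V : T} (f : U ⟶ V) :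
    D.F.map (X.F.map (D.F.map (X.F.map f))) ≫ D.F.map (b (X.F.obj V)) =
      D.F.map (b (X.F.obj U)) ≫ D.F.map (X.F.map f) := by
  rw [← Functor.map_comp, ← Functor.map_comp, hb]

lemma mul_δ (b : ∀ Y : M, X.F.obj (D.F.obj Y) ⟶ Y)
    (hb : ∀ {Y Z : M} (g : Y ⟶ Z), X.F.map (D.F.map g) ≫ b Z = b Y ≫ g)
    (hδ : ∀ (U : T) (Y : M),
      b (U ⊙ₗ Y) = (X.F.map (D.δ U Y) ≫ X.δ U (D.F.obj Y)) ≫ U ⊴ₗ b Y) (U V : T) :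
    D.F.map (b (X.F.obj (U ⊙ₗ V))) ≫ D.F.map (X.δ U V) ≫ D.δ U (X.F.obj V) =
      (D.F.map (X.F.map (D.F.map (X.δ U V) ≫ D.δ U (X.F.obj V))) ≫
        D.F.map (X.δ U _) ≫ D.δ U _) ≫ U ⊴ₗ D.F.map (b (X.F.obj V)) := by
  rw [← Functor.map_comp_assoc, ← hb, hδ]
  simp only [Functor.map_comp, Category.assoc]
  rw [Functor.OplaxLeftLinear.δₗ_naturality_right]

lemma one_naturality (e : ∀ U : T, U ⟶ D.F.obj (X.F.obj U)) (k : ∀ Y : M, Y ⟶ Y)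
    (he : ∀ {U V : T} (f : U ⟶ V), f ≫ e V = e U ≫ D.F.map (X.F.map f))
    (hk : ∀ {Y Z : M} (g : Y ⟶ Z), g ≫ k Z = k Y ≫ g) {U V : T} (f : U ⟶ V) :
    f ≫ e V ≫ D.F.map (k (X.F.obj V)) =
      (e U ≫ D.F.map (k (X.F.obj U))) ≫ D.F.map (X.F.map f) := by
  rw [← Category.assoc, he, Category.assoc, Category.assoc, ← Functor.map_comp,
    ← Functor.map_comp, hk]

lemma one_δ (e : ∀ U : T, U ⟶ D.F.obj (X.F.obj U)) (k : ∀ Y : M, Y ⟶ Y)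
    (hk : ∀ {Y Z : M} (g : Y ⟶ Z), g ≫ k Z = k Y ≫ g)
    (heδ : ∀ U V : T, e (U ⊙ₗ V) ≫ D.F.map (X.δ U V) ≫ D.δ U (X.F.obj V) = U ⊴ₗ e V)
    (hkδ : ∀ (U : T) (Y : M), k (U ⊙ₗ Y) = U ⊴ₗ k Y) (U V : T) :
    (e (U ⊙ₗ V) ≫ D.F.map (k (X.F.obj (U ⊙ₗ V)))) ≫ D.F.map (X.δ U V) ≫ D.δ U (X.F.obj V) =
      𝟙 (U ⊙ₗ V) ≫ U ⊴ₗ (e V ≫ D.F.map (k (X.F.obj V))) := by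
  rw [Category.id_comp, MonoidalLeftAction.actionHomRight_comp, ← heδ, Category.assoc,
    ← Functor.map_comp_assoc, ← hk, Functor.map_comp_assoc, hkδ,
    Functor.OplaxLeftLinear.δₗ_naturality_right]
  simp only [Category.assoc]

end

variable {X : ModuleFunctor T T M}

/-- The pair of pants algebra `X ⊗ X*` in `End_T(T)`, for a 1-morphism `X : T → M` with right dual
`[X*, η, ε]` and `n` the positive square root of its left dimension. The multiplication is
`𝟙_X ⊗ (n⁻¹ ∘ η†) ⊗ 𝟙_{X*}` and the unit is `(𝟙_X ⊗ n ⊗ 𝟙_{X*}) ∘ ε†`. -/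
def pairOfPants (D : RightDual X) (n : idFunctor T M ≅ idFunctor T M) : EndAlgebra T where
  H := X.comp D.dual
  mul := mkHom
    { app := fun U => D.dual.F.map (app (D.η† ≫ n.inv) (X.F.obj U))
      naturality := fun _ _ f => mul_naturality X D.dual (fun Y => app (D.η† ≫ n.inv) Y)
        (fun g => naturality (D.η† ≫ n.inv) g) f }
    (fun U V => mul_δ X D.dual (fun Y => app (D.η† ≫ n.inv) Y)
      (fun g => naturality (D.η† ≫ n.inv) g)
      (fun U Y => (Category.comp_id _).symm.trans (app_δ (D.η† ≫ n.inv) U Y)) U V)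
  one := mkHom
    { app := fun U => app (D.ε†) U ≫ D.dual.F.map (app n.hom (X.F.obj U))
      naturality := fun _ _ f => one_naturality X D.dual (fun U => app (D.ε†) U)
        (fun Y => app n.hom Y) (fun g => naturality (D.ε†) g) (fun g => naturality n.hom g) f }
    (fun U V => one_δ X D.dual (fun U => app (D.ε†) U) (fun Y => app n.hom Y)
      (fun g => naturality n.hom g)
      (fun U V => (app_δ (D.ε†) U V).trans (Category.id_comp _))
      (fun U Y => (Category.comp_id _).symm.trans ((app_δ n.hom U Y).trans (Category.id_comp _)))
      U V)

end RightDual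

variable [RigidCStarTensorCategory T]

/-- `A ≅ X ⊗ X*`: the object `X` of `M`, considered as a 1-morphism `T → M`, is separable, and `A`,
considered as an algebra in `End_T(T)`, is unitarily `*`-isomorphic to the pair of pants algebra
`X ⊗ X*` for a standard right dual `X*`. -/
def IsIsoPairOfPants (A : SSFA T) (X : M) : Prop :=
  ∃ (D : RightDual (ofObj (T := T) X)) (n : idFunctor T M ≅ idFunctor T M),
    D.IsStandard ∧ D.IsSeparable ∧ D.IsSqrtDimLeft n ∧
      ∃ θ : A.toEnd.H ⟶ (D.pairOfPants n).H,
        EndAlgebra.IsUnitaryStarIso (P := A.toEnd) (Q := D.pairOfPants n) θ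

end Duals

end CStarMod

/-! Everything reduces to one dimension count, dim Hom(𝟙, A) = dim End X, followed by the remark
that dim Hom(𝟙, A) = 1 already forces `A` to be simple.

For the count, a dagger makes every one-sided dual two-sided. The snake equations say that `X*` is
left adjoint to `X`, with unit η and counit ε; applying † to them gives an adjunction in the other
direction, with unit ε† and counit η†. Hence Hom(U, X* V) ≅ Hom(X U, V) (`RightDual.homEquiv`).
Under `T ≃ End_T(T)` an algebra is recovered, up to a unitor, as the value of its functor at 𝟙, so
`A` is isomorphic to X*(𝟙 ⊙ X), and Hom(𝟙, A) ≅ Hom(𝟙 ⊙ X, 𝟙 ⊙ X) ≅ End X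
(`IsIsoPairOfPants.finrank_hom_unit`).

For simplicity, a bimodule endomorphism f is in particular left `A`-linear, so f(a) = f(a · 1) = a ·
f(1) and f is determined by f ∘ η. Thus End(_A A_A) embeds into Hom(𝟙, A)
(`SSFA.isSimple_of_finrank_hom_unit`). -/

namespace CStarMod

open scoped MonObj

/-! ### The two adjunctions between a module functor and its dual. -/

section Adjunction

open ModuleFunctor

variable {T : Type u₁} [Category.{v₁} T] [Preadditive T] [Linear ℂ T] [CStarCategory T]
  [MonoidalCategory T]
  {M : Type u₂} [Category.{v₂} M] [Preadditive M] [Linear ℂ M] [CStarCategory M]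
  [MonoidalLeftAction T M] [SemisimpleModuleCategory T M]
  {N : Type u₃} [Category.{v₃} N] [Preadditive N] [Linear ℂ N] [CStarCategory N]
  [MonoidalLeftAction T N] [SemisimpleModuleCategory T N]

namespace RightDual

variable {X : ModuleFunctor T M N} (D : RightDual X)

/-- The components `V ⟶ X X* V` of the cup. -/
def cup (V : N) : V ⟶ X.F.obj (D.dual.F.obj V) := app D.η V

/-- The components `X* X U ⟶ U` of the cap. -/
def cap (U : M) : D.dual.F.obj (X.F.obj U) ⟶ U := app D.ε U

/-- This and the next lemma are the triangle identities of the adjunction X* ⊣ X, with unit `cup`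
and counit `cap`. -/
lemma cup_comp_map_cap (U : M) : D.cup (X.F.obj U) ≫ X.F.map (D.cap U) = 𝟙 (X.F.obj U) :=
  D.snake_left U

lemma map_cup_comp_cap (V : N) :
    D.dual.F.map (D.cup V) ≫ D.cap (D.dual.F.obj V) = 𝟙 (D.dual.F.obj V) :=
  D.snake_right V

/-- The components `X X* V ⟶ V` of the dagger of the cup. -/
def counit (V : N) : X.F.obj (D.dual.F.obj V) ⟶ V := (D.cup V)†

/-- The components `U ⟶ X* X U` of the dagger of the cap. -/
def unit (U : M) : U ⟶ D.dual.F.obj (X.F.obj U) := (D.cap U)†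

/-- The componentwise dagger of a morphism of module functors is again one, hence natural. The same
reason gives `unit_naturality`. -/
lemma counit_naturality {V W : N} (h : V ⟶ W) :
    X.F.map (D.dual.F.map h) ≫ D.counit W = D.counit V ≫ h :=
  naturality (D.η†) h

lemma unit_naturality {U V : M} (g : U ⟶ V) :
    g ≫ D.unit V = D.unit U ≫ D.dual.F.map (X.F.map g) :=
  naturality (D.ε†) g

/-- The dagger reverses composition and commutes with module functors, so it turns a triangle
identity of X* ⊣ X into one of X ⊣ X*. The next lemma treats the other triangle in the same way. -/
lemma map_unit_comp_counit (U : M) :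
    X.F.map (D.unit U) ≫ D.counit (X.F.obj U) = 𝟙 (X.F.obj U) := by
  rw [unit, counit, X.map_dagger, ← DaggerCategory.dagger_comp, cup_comp_map_cap,
    DaggerCategory.dagger_id]

lemma unit_comp_map_counit (V : N) :
    D.unit (D.dual.F.obj V) ≫ D.dual.F.map (D.counit V) = 𝟙 (D.dual.F.obj V) := by
  rw [unit, counit, D.dual.map_dagger, ← DaggerCategory.dagger_comp, map_cup_comp_cap,
    DaggerCategory.dagger_id]

/-- The daggers of the cup and the cap make `X*` a right adjoint of `X`:
`Hom(U, X* V) ≃ Hom(X U, V)`. -/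
def homEquiv (U : M) (V : N) : (U ⟶ D.dual.F.obj V) ≃ₗ[ℂ] (X.F.obj U ⟶ V) where
  toFun g := X.F.map g ≫ D.counit V
  invFun h := D.unit U ≫ D.dual.F.map h
  map_add' f g := by rw [X.map_add, Preadditive.add_comp]
  map_smul' z f := by rw [X.map_smul, Linear.smul_comp, RingHom.id_apply]
  -- Both inverse laws are the usual adjunction argument: naturality moves the given morphism past
  -- the unit or the counit, and a triangle identity removes what is left.
  left_inv g := by
    simp only [Functor.map_comp]
    rw [← Category.assoc, ← unit_naturality, Category.assoc, unit_comp_map_counit,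
      Category.comp_id]
  right_inv h := by
    simp only [Functor.map_comp, Category.assoc]
    rw [counit_naturality, ← Category.assoc, map_unit_comp_counit, Category.id_comp]

end RightDual

/-- The components of a unitary morphism of module functors are isomorphisms. -/
def ModuleFunctor.appIso {G H : ModuleFunctor T M N} {θ : G ⟶ H} (hθ : IsUnitary θ) (U : M) :
    G.F.obj U ≅ H.F.obj U where
  hom := app θ U
  inv := app (θ†) U
  hom_inv_id := by rw [← comp_app, hθ.1, id_app]
  inv_hom_id := by rw [← comp_app, hθ.2, id_app]

/-- If `A ≅ X ⊗ X*`, then `Hom(𝟙, A)` and `End X` have the same dimension. -/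
lemma IsIsoPairOfPants.finrank_hom_unit [RigidCStarTensorCategory T] {A : SSFA T} {X : M}
    (h : IsIsoPairOfPants A X) :
    Module.finrank ℂ (𝟙_ T ⟶ A.X) = Module.finrank ℂ (X ⟶ X) := by
  obtain ⟨D, n, -, -, -, θ, hθ⟩ := h
  -- The functor - ⊗ A takes the value 𝟙 ⊗ A at the unit object, so a left unitor precedes the
  -- component of θ.
  let i : A.X ≅ D.dual.F.obj (𝟙_ T ⊙ₗ X) := (λ_ A.X).symm ≪≫ appIso hθ.unitary (𝟙_ T)
  let e₁ : (𝟙_ T ⟶ A.X) ≃ₗ[ℂ] (𝟙_ T ⟶ D.dual.F.obj (𝟙_ T ⊙ₗ X)) :=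
    Linear.homCongr ℂ (Iso.refl _) i
  -- The functor attached to X sends 𝟙 to 𝟙 ⊙ X by definition, so the adjunction applies with U = 𝟙.
  let e₂ : (𝟙_ T ⟶ D.dual.F.obj (𝟙_ T ⊙ₗ X)) ≃ₗ[ℂ] (𝟙_ T ⊙ₗ X ⟶ 𝟙_ T ⊙ₗ X) :=
    D.homEquiv (𝟙_ T) (𝟙_ T ⊙ₗ X)
  let e₃ : (𝟙_ T ⊙ₗ X ⟶ 𝟙_ T ⊙ₗ X) ≃ₗ[ℂ] (X ⟶ X) :=
    Linear.homCongr ℂ (λₗ[T] X) (λₗ[T] X)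
  exact ((e₁.trans e₂).trans e₃).finrank_eq

end Adjunction

/-! ### Bimodule endomorphisms and the unit of the algebra. -/

namespace SSFA

variable {T : Type u₁} [Category.{v₁} T] [Preadditive T] [Linear ℂ T] [CStarCategory T]
  [MonoidalCategory T]

/-- An endomorphism of the left module `A` is determined by its composite with the unit. -/
lemma eq_of_one_comp_eq (A : SSFA T) {f g : A.X ⟶ A.X} (hf : μ[A.X] ≫ f = A.X ◁ f ≫ μ[A.X])
    (hg : μ[A.X] ≫ g = A.X ◁ g ≫ μ[A.X]) (h : η[A.X] ≫ f = η[A.X] ≫ g) : f = g := by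
  -- In elements: k(a) = k(a · 1) = a · k(1).
  have key : ∀ k : A.X ⟶ A.X, μ[A.X] ≫ k = A.X ◁ k ≫ μ[A.X] →
      (ρ_ A.X).hom ≫ k = A.X ◁ (η[A.X] ≫ k) ≫ μ[A.X] := fun k hk => by
    rw [MonoidalCategory.whiskerLeft_comp, Category.assoc, ← hk, ← Category.assoc, MonObj.mul_one]
  rw [← cancel_epi (ρ_ A.X).hom, key f hf, key g hg, h]

variable [MonoidalPreadditive T] [MonoidalLinear ℂ T]

/-- If `Hom(𝟙, A)` is one-dimensional, then `A` is simple. -/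
lemma isSimple_of_finrank_hom_unit (A : SSFA T) (h : Module.finrank ℂ (𝟙_ T ⟶ A.X) = 1) :
    A.IsSimple := by
  -- `finrank` is 0 on infinite-dimensional spaces, so the value 1 carries finiteness; the
  -- comparison of dimensions below needs it.
  have : FiniteDimensional ℂ (𝟙_ T ⟶ A.X) := Module.finite_of_finrank_eq_succ h
  let Φ : A.bimoduleEnd →ₗ[ℂ] (𝟙_ T ⟶ A.X) := Linear.leftComp ℂ _ η[A.X] ∘ₗ A.bimoduleEnd.subtype
  have hΦ : Function.Injective Φ := fun f g hfg =>
    Subtype.ext (A.eq_of_one_comp_eq f.2.1 g.2.1 hfg)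
  have : FiniteDimensional ℂ A.bimoduleEnd := Module.Finite.of_injective Φ hΦ
  obtain ⟨v, hv⟩ : ∃ v : 𝟙_ T ⟶ A.X, v ≠ 0 := by
    have := Module.nontrivial_of_finrank_pos (h ▸ Nat.one_pos)
    exact exists_ne 0
  -- If the identity of A vanished, so would every morphism 𝟙 ⟶ A. Hence the identity is a nonzero
  -- bimodule endomorphism, which gives the lower bound on the dimension.
  have hid : 𝟙 A.X ≠ 0 := fun h0 => hv (by rw [← Category.comp_id v, h0, Limits.comp_zero])
  have : Nontrivial A.bimoduleEnd :=
    ⟨⟨𝟙 A.X, by simp, by simp⟩, 0, fun h0 => hid (congrArg Subtype.val h0)⟩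
  exact le_antisymm (h ▸ LinearMap.finrank_le_finrank_of_injective hΦ) Module.finrank_pos

end SSFA

end CStarMod

theorem mainTheorem8
    {T : Type*} [Category* T] [Preadditive T] [Linear ℂ T] [CStarMod.CStarCategory T]
    [MonoidalCategory T] [CStarMod.RigidCStarTensorCategory T]
    {M : Type*} [Category* M] [Preadditive M] [Linear ℂ M] [CStarMod.CStarCategory M]
    [MonoidalLeftAction T M] [CStarMod.SemisimpleModuleCategory T M]
    (hcof : CStarMod.IsCofinite T M) (hdec : CStarMod.IsFinitelyDecomposable T M)
    (A : CStarMod.SSFA T) (X : M) (hAX : CStarMod.IsIsoPairOfPants A X) :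
    (A.IsConnected ↔ CStarMod.IsSimpleObject X) ∧
      (Module.finrank ℂ (𝟙_ T ⟶ A.X) = 1 ↔ CStarMod.IsSimpleObject X) := by
  have hX := hAX.finrank_hom_unit
  have h : Module.finrank ℂ (𝟙_ T ⟶ A.X) = 1 ↔ CStarMod.IsSimpleObject X := by
    rw [hX, CStarMod.IsSimpleObject]
  -- The second half of connectedness is the dimension condition; the first half, simplicity,
  -- follows from it.
  exact ⟨⟨fun hA => h.1 hA.2, fun hs => ⟨A.isSimple_of_finrank_hom_unit (h.2 hs), h.2 hs⟩⟩, h⟩
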